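/- **Theorem 3.2.** Let $k$ be an algebraically closed field of characteristic $0$, and let $p\in k[X,Y]$ be an irreducible polynomial with $p\notin k[X]$ and $p\notin k[Y]$. Let $C\subset\mathbb P^1\times\mathbb P^1$ be the curve defined by the bi-homogenization $x_0^{\deg_x p}\,y_0^{\deg_y p}\,p(x_1/x_0,\,y_1/y_0)$. Regard $C$ as a binary relation between two copies of $\mathbb P^1$, and write ${}^{\mathrm{tr}}C$ for its transpose, so that ${}^{\mathrm{tr}}C\circ C$ relates $z$ to $w$ if and only if there is a $y\in\mathbb P^1$ with $(z,y)\in C$ and $(w,y)\in C$. Let $({}^{\mathrm{tr}}C\circ C)^{(n)}$ be its $n$-fold iterate. The correspondence is called finite if $({}^{\mathrm{tr}}C\circ C)^{(n)}=({}^{\mathrm{tr}}C\circ C)^{(n+1)}$ for some integer $n\ge 1$, and infinite otherwise. An orbit is an equivalence class of the smallest equivalence relation on the points of $C$ under which $(z_1,z_2)$ and $(w_1,w_2)$ are equivalent whenever $z_1=w_1$ or $z_2=w_2$. If the curve $C$ is normal and the correspondence is infinite, then only finitely many of its orbits are finite sets. Moreover, their number is bounded by a function of the degree of $p$ alone: there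 is a function $B:\mathbb N\to\mathbb N$, independent of $k$ and $p$, such that for all such $k$ and $p$ the number of finite orbits is at most $B(\deg p)$, where $\deg p$ is the total degree. -/

import Mathlib

open scoped LinearAlgebra.Projectivization

noncomputable section

namespace PlaneCorrespondence

variable {k : Type*} [Field k]

/-- The projective line over `k`. A point `[v 0 : v 1]` is the class of a non-zero vector `v`;
the affine coordinate is `v 1 / v 0`. -/
abbrev P1 (k : Type*) [Field k] : Type _ := ℙ k (Fin 2 → k)

/-- The bi-homogenization `x₀ ^ deg_x p * y₀ ^ deg_y p * p (x₁ / x₀, y₁ / y₀)` of `p (X, Y)`, where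
`X 0, X 1` stand for `X, Y`. The variable `X (0, j)` is `x_j` and the variable `X (1, j)` is
`y_j`. -/
def biHomogenization (p : MvPolynomial (Fin 2) k) : MvPolynomial (Fin 2 × Fin 2) k :=
  ∑ m ∈ p.support, MvPolynomial.C (p.coeff m) *
    ∏ i : Fin 2, (MvPolynomial.X (i, 0) ^ (p.degreeOf i - m i) * MvPolynomial.X (i, 1) ^ m i)

/-- The value of the bi-homogenization of `p` at `x = v` and `y = w`. -/
def biEval (p : MvPolynomial (Fin 2) k) (v w : Fin 2 → k) : k :=
  MvPolynomial.eval (fun ij => if ij.1 = 0 then v ij.2 else w ij.2) (biHomogenization p)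

/-- The curve `C` in `ℙ¹ × ℙ¹`, that is, the zero set of the bi-homogenization of `p`, viewed as a
binary relation between two projective lines. The choice of the representatives is irrelevant, see
`mem_curve_mk`. -/
def curve (p : MvPolynomial (Fin 2) k) : SetRel (P1 k) (P1 k) :=
  {P | biEval p P.1.rep P.2.rep = 0}

lemma biEval_eq (p : MvPolynomial (Fin 2) k) (v w : Fin 2 → k) :
    biEval p v w = ∑ m ∈ p.support, p.coeff m *
      ((v 0 ^ (p.degreeOf 0 - m 0) * v 1 ^ m 0) * (w 0 ^ (p.degreeOf 1 - m 1) * w 1 ^ m 1)) := by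
  simp [biEval, biHomogenization, Fin.prod_univ_two]

lemma biEval_smul (p : MvPolynomial (Fin 2) k) (s t : k) (v w : Fin 2 → k) :
    biEval p (s • v) (t • w) = s ^ p.degreeOf 0 * t ^ p.degreeOf 1 * biEval p v w := by
  rw [biEval_eq, biEval_eq, Finset.mul_sum]
  refine Finset.sum_congr rfl fun m hm => ?_
  have h0 := MvPolynomial.degreeOf_le_iff.1 (le_refl (p.degreeOf 0)) m hm
  have h1 := MvPolynomial.degreeOf_le_iff.1 (le_refl (p.degreeOf 1)) m hm
  have e0 : s ^ p.degreeOf 0 = s ^ (p.degreeOf 0 - m 0) * s ^ m 0 := by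
    rw [← pow_add, Nat.sub_add_cancel h0]
  have e1 : t ^ p.degreeOf 1 = t ^ (p.degreeOf 1 - m 1) * t ^ m 1 := by
    rw [← pow_add, Nat.sub_add_cancel h1]
  rw [e0, e1]
  simp only [Pi.smul_apply, smul_eq_mul, mul_pow]
  ring

/-- Membership in the curve may be tested on any homogeneous coordinates. -/
lemma mem_curve_mk (p : MvPolynomial (Fin 2) k) (v w : Fin 2 → k) (hv : v ≠ 0) (hw : w ≠ 0) :
    (Projectivization.mk k v hv, Projectivization.mk k w hw) ∈ curve p ↔ biEval p v w = 0 := by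
  obtain ⟨s, hs⟩ := Projectivization.exists_smul_eq_mk_rep k v hv
  obtain ⟨t, ht⟩ := Projectivization.exists_smul_eq_mk_rep k w hw
  have h : biEval p (Projectivization.mk k v hv).rep (Projectivization.mk k w hw).rep =
      (s : k) ^ p.degreeOf 0 * (t : k) ^ p.degreeOf 1 * biEval p v w := by
    rw [← hs, ← ht]
    exact biEval_smul p s t v w
  change biEval p _ _ = 0 ↔ _
  rw [h]
  simp

/-- On the affine chart `x₀ = y₀ = 1` the curve is the zero set of `p`. -/
lemma biEval_affine (p : MvPolynomial (Fin 2) k) (a b : k) :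
    biEval p ![1, a] ![1, b] = MvPolynomial.eval ![a, b] p := by
  rw [biEval_eq, MvPolynomial.eval_eq']
  simp [Fin.prod_univ_two]

/-- The equation of the curve in the affine chart of `ℙ¹ × ℙ¹` where `x_{a 0} = 1` and
`y_{a 1} = 1`: the bi-homogenization of `p` with these variables set to `1`, the other homogeneous
coordinate of each line being the affine coordinate. -/
def chartPoly (p : MvPolynomial (Fin 2) k) (a : Fin 2 → Fin 2) : MvPolynomial (Fin 2) k :=
  MvPolynomial.aeval
    (fun ij : Fin 2 × Fin 2 =>
      if ij.2 = a ij.1 then (1 : MvPolynomial (Fin 2) k) else MvPolynomial.X ij.1)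
    (biHomogenization p)

/-- In the chart `x₀ = y₀ = 1` the equation is `p` itself. -/
lemma chartPoly_zero (p : MvPolynomial (Fin 2) k) : chartPoly p 0 = p := by
  conv_rhs => rw [p.as_sum]
  simp only [chartPoly, biHomogenization, map_sum, map_mul, map_prod, map_pow,
    MvPolynomial.aeval_X, MvPolynomial.aeval_C, Pi.zero_apply]
  refine Finset.sum_congr rfl fun m _ => ?_
  rw [MvPolynomial.monomial_eq, Finsupp.prod_fintype _ _ (by simp)]
  simp [MvPolynomial.algebraMap_eq]

/-- The coordinate ring of the curve in an affine chart of `ℙ¹ × ℙ¹`. -/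
abbrev ChartRing (p : MvPolynomial (Fin 2) k) (a : Fin 2 → Fin 2) : Type _ :=
  MvPolynomial (Fin 2) k ⧸ Ideal.span {chartPoly p a}

/-- The curve is normal: its coordinate rings in the four affine charts that cover `ℙ¹ × ℙ¹` are
integrally closed in their fields of fractions (equivalently, for irreducible `p`, all of its local
rings are). -/
def IsNormalCurve (p : MvPolynomial (Fin 2) k) : Prop :=
  ∀ a : Fin 2 → Fin 2, IsIntegrallyClosed (ChartRing p a)

/-- The `n`-fold iterate `R^(n)` of a binary relation `R` on a set. -/
def iter {α : Type*} (R : SetRel α α) : ℕ → SetRel α α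
  | 0 => SetRel.id
  | n + 1 => (iter R n).comp R

/-- The composite `ᵗʳC ∘ C` (first `C`, then its transpose): `z` is related to `w` if there is a
`y` with `(z, y) ∈ C` and `(w, y) ∈ C`. -/
def roundTrip (p : MvPolynomial (Fin 2) k) : SetRel (P1 k) (P1 k) :=
  (curve p).comp (curve p).inv

/-- The correspondence is finite: `(ᵗʳC ∘ C)^(n) = (ᵗʳC ∘ C)^(n+1)` for some positive `n`. -/
def IsFiniteCorrespondence (p : MvPolynomial (Fin 2) k) : Prop :=
  ∃ n : ℕ, 0 < n ∧ iter (roundTrip p) n = iter (roundTrip p) (n + 1)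

/-- The smallest equivalence relation on the points of `C` for which points with the same first or
the same second coordinate are equivalent. -/
def orbitSetoid (p : MvPolynomial (Fin 2) k) : Setoid (curve p) :=
  Relation.EqvGen.setoid fun z w => z.1.1 = w.1.1 ∨ z.1.2 = w.1.2

/-- The set of those orbits (equivalence classes) that are finite sets. -/
def finiteOrbits (p : MvPolynomial (Fin 2) k) : Set (Set (curve p)) :=
  {O | O ∈ (orbitSetoid p).classes ∧ O.Finite}

end PlaneCorrespondence

end

/-! Call a value of a coordinate exceptional if it is infinite or a zero of the resultant of `p` and
its derivative in the other variable. Distinct orbits share no value of either coordinate, so the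
orbits meeting an exceptional value are bounded in number by the exceptional values. It remains to
see that an infinite correspondence has at most one finite orbit without exceptional values.

Suppose there are two, with coordinate sets `A` and `A'`. On the function field of the curve, with
coordinates x and y, let f₀(x), f₁(y) be the monic polynomials with simple roots at `A 0`, `A 1`.
Since the curve is unramified in both directions over these values and stays affine there, f₀(x) and
f₁(y) have the same order at every finite place (`valuation_rootPoly_le`). Their orders can differ
only at infinity, and there the defect is cancelled by a suitable power of the same quotient for
`A'`: (f₁/f₀)^α (f₀'/f₁')^β has value one at every place (`valuation_rootPoly_mul_eq`). Hence it is
a constant c (`exists_dvd_separated`).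

Separating variables, the rational function f₀'^β/f₀^α of the first coordinate equals c·f₁'^β/f₁^α
of the second on the whole curve (`rootForm_relation`). It is therefore constant along the
correspondence. Its fibres have bounded size, so the iterates stabilize (`iter_eq_iter_succ`) and
the correspondence is finite, a contradiction. -/

open scoped LinearAlgebra.Projectivization

noncomputable section

namespace PlaneCorrespondence

/-! ### Specializing one variable; `p` as a polynomial in one variable over k[other]. -/

section Slices

variable {k : Type*} [Field k]

/-- Evaluation of a polynomial in two variables, as a sum over its monomials. -/
lemma aeval_eq_sum_of_ne {K : Type*} [CommRing K] [Algebra k K] (p : MvPolynomial (Fin 2) k)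
    {i j : Fin 2} (hij : i ≠ j) (t : Fin 2 → K) :
    MvPolynomial.aeval t p =
      ∑ m ∈ p.support, algebraMap k K (p.coeff m) * (t i ^ m i * t j ^ m j) := by
  rw [MvPolynomial.aeval_def, MvPolynomial.eval₂_eq']
  refine Finset.sum_congr rfl fun m _ => ?_
  rw [Fin.prod_univ_two]
  fin_cases i <;> fin_cases j <;> simp_all [mul_comm]

/-- The polynomial in one variable obtained by setting the variable `i` to `a`. -/
def slice (i : Fin 2) (a : k) (p : MvPolynomial (Fin 2) k) : Polynomial k :=
  MvPolynomial.aeval (fun l => if l = i then Polynomial.C a else Polynomial.X) p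

/-- A polynomial in two variables as a polynomial whose coefficients are polynomials in the
variable `i`. -/
def toBivariate (i : Fin 2) (p : MvPolynomial (Fin 2) k) : Polynomial (Polynomial k) :=
  MvPolynomial.aeval (fun l => if l = i then Polynomial.C Polynomial.X else Polynomial.X) p

lemma toBivariate_map_eval (i : Fin 2) (a : k) (p : MvPolynomial (Fin 2) k) :
    (toBivariate i p).map (Polynomial.evalRingHom a) = slice i a p := by
  induction p using MvPolynomial.induction_on with
  | C c => simp [toBivariate, slice, Polynomial.algebraMap_apply]
  | add p q hp hq => simp_all [toBivariate, slice]
  | mul_X p l hp =>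
    simp only [toBivariate, slice, map_mul, Polynomial.map_mul, MvPolynomial.aeval_X] at hp ⊢
    rw [hp]
    split_ifs <;> simp

lemma slice_eval {i j : Fin 2} (hij : i ≠ j) (a : k) (t : Fin 2 → k) (hi : t i = a)
    (p : MvPolynomial (Fin 2) k) : (slice i a p).eval (t j) = MvPolynomial.eval t p := by
  have h := aeval_eq_sum_of_ne p hij t
  rw [MvPolynomial.aeval_eq_eval] at h
  rw [slice, aeval_eq_sum_of_ne p hij, h, Polynomial.eval_finsetSum]
  simp [hij.symm, hi]

lemma coeff_coeff_toBivariate {i j : Fin 2} (hij : i ≠ j) (p : MvPolynomial (Fin 2) k)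
    (m : Fin 2 →₀ ℕ) : ((toBivariate i p).coeff (m j)).coeff (m i) = p.coeff m := by
  have key : ∀ m' : Fin 2 →₀ ℕ, (m i = m' i ∧ m j = m' j) ↔ m' = m := by
    intro m'
    constructor
    · rintro ⟨h1, h2⟩
      ext l
      have hl : l = i ∨ l = j := by omega
      rcases hl with rfl | rfl
      exacts [h1.symm, h2.symm]
    · rintro rfl; simp
  rw [toBivariate, aeval_eq_sum_of_ne p hij, Polynomial.finsetSum_coeff,
    Polynomial.finsetSum_coeff]
  have : ∀ m' ∈ p.support, ((algebraMap k (Polynomial (Polynomial k)) (p.coeff m') *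
      ((if i = i then Polynomial.C Polynomial.X else Polynomial.X) ^ m' i *
        (if j = i then Polynomial.C Polynomial.X else Polynomial.X) ^ m' j)).coeff (m j)).coeff
          (m i) = if m' = m then p.coeff m' else 0 := by
    intro m' _
    simp only [if_true, hij.symm, if_false, Polynomial.algebraMap_apply,
      Algebra.algebraMap_self_apply, ← Polynomial.C_pow, Polynomial.coeff_C_mul,
      Polynomial.coeff_X_pow]
    simp only [← key m']
    split_ifs <;> simp_all [Polynomial.coeff_X_pow]
  rw [Finset.sum_congr rfl this]
  simp +contextual [eq_comm]

lemma exists_finsupp_eq {i j : Fin 2} (hij : i ≠ j) (a b : ℕ) :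
    ∃ m : Fin 2 →₀ ℕ, m i = a ∧ m j = b :=
  ⟨Finsupp.single i a + Finsupp.single j b, by simp [hij, hij.symm]⟩

lemma natDegree_toBivariate {i j : Fin 2} (hij : i ≠ j) (p : MvPolynomial (Fin 2) k) :
    (toBivariate i p).natDegree = p.degreeOf j := by
  apply le_antisymm
  · rw [Polynomial.natDegree_le_iff_coeff_eq_zero]
    intro N hN
    ext l
    obtain ⟨m, rfl, rfl⟩ := exists_finsupp_eq hij l N
    rw [coeff_coeff_toBivariate hij, Polynomial.coeff_zero]
    by_contra h
    exact absurd (MvPolynomial.degreeOf_le_iff.1 le_rfl m (MvPolynomial.mem_support_iff.2 h))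
      (not_le.2 hN)
  · rw [MvPolynomial.degreeOf_le_iff]
    intro m hm
    apply Polynomial.le_natDegree_of_ne_zero
    intro h
    have := coeff_coeff_toBivariate hij p m
    rw [h, Polynomial.coeff_zero] at this
    exact MvPolynomial.mem_support_iff.1 hm this.symm

lemma natDegree_coeff_toBivariate_le {i j : Fin 2} (hij : i ≠ j) (p : MvPolynomial (Fin 2) k)
    (n : ℕ) : ((toBivariate i p).coeff n).natDegree ≤ p.degreeOf i := by
  rw [Polynomial.natDegree_le_iff_coeff_eq_zero]
  intro N hN
  obtain ⟨m, rfl, rfl⟩ := exists_finsupp_eq hij N n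
  rw [coeff_coeff_toBivariate hij]
  by_contra h
  exact absurd (MvPolynomial.degreeOf_le_iff.1 le_rfl m (MvPolynomial.mem_support_iff.2 h))
    (not_le.2 hN)

lemma natDegree_slice_le {i j : Fin 2} (hij : i ≠ j) (a : k) (p : MvPolynomial (Fin 2) k) :
    (slice i a p).natDegree ≤ p.degreeOf j := by
  rw [← toBivariate_map_eval, ← natDegree_toBivariate hij]
  exact Polynomial.natDegree_map_le

/-- Both choices of `i` are ring isomorphisms: the standard one onto k[X][Y], and that one followed
by the swap. -/
lemma irreducible_toBivariate (i : Fin 2) {p : MvPolynomial (Fin 2) k} (hp : Irreducible p) :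
    Irreducible (toBivariate i p) := by
  let e := (Polynomial.Bivariate.equivMvPolynomial k).symm
  have h0 : ∀ q, toBivariate 0 q = e q := by
    intro q
    have : (MvPolynomial.aeval (fun l : Fin 2 => if l = 0 then Polynomial.C Polynomial.X else
        Polynomial.X) : MvPolynomial (Fin 2) k →ₐ[k] Polynomial (Polynomial k)) =
        e.toAlgHom := by
      apply MvPolynomial.algHom_ext
      intro l
      fin_cases l <;> simp [e]
    exact DFunLike.congr_fun this q
  have h1 : ∀ q, toBivariate 1 q = Polynomial.Bivariate.swap (e q) := by
    intro q
    have : (MvPolynomial.aeval (fun l : Fin 2 => if l = 1 then Polynomial.C Polynomial.X else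
        Polynomial.X) : MvPolynomial (Fin 2) k →ₐ[k] Polynomial (Polynomial k)) =
        (e.trans Polynomial.Bivariate.swap).toAlgHom := by
      apply MvPolynomial.algHom_ext
      intro l
      fin_cases l
      · simpa [e] using Polynomial.Bivariate.swap_X.symm
      · simpa [e] using Polynomial.Bivariate.swap_Y.symm
    exact DFunLike.congr_fun this q
  have h2 : i = 0 ∨ i = 1 := by omega
  rcases h2 with rfl | rfl
  · rw [h0]; exact (MulEquiv.irreducible_iff e).2 hp
  · rw [h1]
    exact (MulEquiv.irreducible_iff (Polynomial.Bivariate.swap (R := k))).2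
      ((MulEquiv.irreducible_iff e).2 hp)

lemma degreeOf_pos_of_notMem_supported {i j : Fin 2} (hij : i ≠ j) {p : MvPolynomial (Fin 2) k}
    (hp : p ∉ MvPolynomial.supported k ({i} : Set (Fin 2))) : 0 < p.degreeOf j := by
  by_contra h
  refine hp (MvPolynomial.mem_supported.2 fun l hl => ?_)
  have : l = i ∨ l = j := by omega
  rcases this with rfl | rfl
  · simp
  · rw [Finset.mem_coe, MvPolynomial.mem_vars_iff_mem_support] at hl
    obtain ⟨m, hm, hl⟩ := hl
    have := MvPolynomial.degreeOf_le_iff.1 (not_lt.1 h) m hm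
    simp at hl
    omega

end Slices

/-! ### Ramification values: resultant with the derivative. -/

section Ramification

variable {k : Type*} [Field k]

lemma natDegree_det_le_of_forall {n : ℕ} (M : Matrix (Fin n) (Fin n) (Polynomial k)) (D : ℕ)
    (h : ∀ i j, (M i j).natDegree ≤ D) : M.det.natDegree ≤ n * D := by
  rw [Matrix.det_apply]
  refine Polynomial.natDegree_sum_le_of_forall_le _ _ fun σ _ => ?_
  refine (Polynomial.natDegree_smul_le _ _).trans ?_
  refine (Polynomial.natDegree_prod_le _ _).trans ?_
  refine (Finset.sum_le_card_nsmul _ _ D fun l _ => h _ _).trans ?_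
  simp

/-- The resultant of `p` and its derivative with respect to the other variable, as a polynomial in
the variable `i`. -/
def ramificationPoly (i : Fin 2) (p : MvPolynomial (Fin 2) k) : Polynomial k :=
  Polynomial.resultant (toBivariate i p) (toBivariate i p).derivative

/-- By Gauss's lemma `p` stays irreducible over the rational function field in the variable `i`; in
characteristic 0 it is then separable, that is, coprime to its derivative. -/
lemma ramificationPoly_ne_zero [CharZero k] {i j : Fin 2} (hij : i ≠ j)
    {p : MvPolynomial (Fin 2) k} (hp : Irreducible p) (hj : 0 < p.degreeOf j) :
    ramificationPoly i p ≠ 0 := by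
  have hirr := irreducible_toBivariate i hp
  have hdeg : (toBivariate i p).natDegree ≠ 0 := by
    rw [natDegree_toBivariate hij]; exact hj.ne'
  let K := FractionRing (Polynomial k)
  have hK : Irreducible ((toBivariate i p).map (algebraMap (Polynomial k) K)) :=
    ((hirr.isPrimitive hdeg).irreducible_iff_irreducible_map_fraction_map).1 hirr
  have hinj := IsFractionRing.injective (Polynomial k) K
  have : CharZero K := charZero_of_injective_algebraMap hinj
  have hsep : IsCoprime _ _ := hK.separable
  rw [Polynomial.derivative_map] at hsep
  intro h
  have h2 := Polynomial.resultant_map_map (toBivariate i p) (toBivariate i p).derivative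
    (toBivariate i p).natDegree (toBivariate i p).derivative.natDegree (algebraMap (Polynomial k) K)
  rw [← ramificationPoly, h, map_zero] at h2
  have h3 := Polynomial.resultant_eq_zero_iff (f := (toBivariate i p).map (algebraMap _ K))
    (g := (toBivariate i p).derivative.map (algebraMap _ K))
  rw [Polynomial.natDegree_map_eq_of_injective hinj, Polynomial.natDegree_map_eq_of_injective hinj]
    at h3
  exact (h3.1 h2).2 hsep

/-- The Sylvester matrix has size at most twice the degree in `j`, and its entries have degree at
most `p.degreeOf i`. -/
lemma natDegree_ramificationPoly_le {i j : Fin 2} (hij : i ≠ j) (p : MvPolynomial (Fin 2) k) :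
    (ramificationPoly i p).natDegree ≤ 2 * p.degreeOf j * p.degreeOf i := by
  have h1 := natDegree_coeff_toBivariate_le hij p
  have h2 : ∀ n, ((toBivariate i p).derivative.coeff n).natDegree ≤ p.degreeOf i := by
    intro n
    rw [Polynomial.coeff_derivative, ← Nat.cast_succ, mul_comm, ← nsmul_eq_mul]
    exact (Polynomial.natDegree_smul_le _ _).trans (h1 _)
  refine (natDegree_det_le_of_forall _ (p.degreeOf i) fun a b => ?_).trans ?_
  · rw [Polynomial.sylvester, Matrix.of_apply]
    refine Fin.addCases (fun b => ?_) (fun b => ?_) b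
    · simp only [Fin.addCases_left]
      split_ifs
      · exact h2 _
      · simp
    · simp only [Fin.addCases_right]
      split_ifs
      · exact h1 _
      · simp
  · have := Polynomial.natDegree_derivative_le (toBivariate i p)
    rw [natDegree_toBivariate hij] at this ⊢
    gcongr
    omega

/-- Specialize the Bézout identity for the resultant rather than the resultant itself; a drop of
degree at `a` then does no harm. -/
lemma separable_slice_of_eval_ne_zero [IsAlgClosed k] {i j : Fin 2} (hij : i ≠ j)
    {p : MvPolynomial (Fin 2) k}
    (hj : 0 < p.degreeOf j) {a : k} (ha : (ramificationPoly i p).eval a ≠ 0) :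
    (slice i a p).Separable := by
  obtain ⟨u, v, -, -, h⟩ := Polynomial.exists_mul_add_mul_eq_C_resultant (toBivariate i p)
    (toBivariate i p).derivative le_rfl le_rfl (.inl (by rw [natDegree_toBivariate hij]; omega))
  have h' := congrArg (Polynomial.map (Polynomial.evalRingHom a)) h
  rw [Polynomial.map_add, Polynomial.map_mul, Polynomial.map_mul, ← Polynomial.derivative_map,
    toBivariate_map_eval, Polynomial.map_C, Polynomial.coe_evalRingHom,
    ← ramificationPoly] at h'
  refine ⟨Polynomial.C ((ramificationPoly i p).eval a)⁻¹ * u.map (Polynomial.evalRingHom a),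
    Polynomial.C ((ramificationPoly i p).eval a)⁻¹ * v.map (Polynomial.evalRingHom a), ?_⟩
  rw [mul_assoc, mul_assoc, ← mul_add, mul_comm (u.map _), mul_comm (v.map _), h', ← Polynomial.C_mul,
    inv_mul_cancel₀ ha, Polynomial.C_1]

end Ramification

/-! ### Orders of the root polynomials at the places of the curve. -/

section Valuations

variable {k : Type*} [Field k]

/-- The monic polynomial with simple roots at the points of a finite set. -/
def rootPoly (A : Finset k) : Polynomial k := ∏ a ∈ A, (Polynomial.X - Polynomial.C a)

lemma rootPoly_monic (A : Finset k) : (rootPoly A).Monic :=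
  Polynomial.monic_prod_X_sub_C _ _

lemma natDegree_rootPoly (A : Finset k) : (rootPoly A).natDegree = A.card := by
  rw [rootPoly, Polynomial.natDegree_prod_of_monic _ _ fun a _ => Polynomial.monic_X_sub_C a]
  simp

lemma eval_rootPoly_eq_zero_iff (A : Finset k) (a : k) : (rootPoly A).eval a = 0 ↔ a ∈ A := by
  simp [rootPoly, Polynomial.eval_prod, Finset.prod_eq_zero_iff, sub_eq_zero]

/-- A pair of finite sets of affine values such that every point of the curve over one of these
values is affine, simple, and lies over the other set. -/
def IsRegularPair (p : MvPolynomial (Fin 2) k) (A : Fin 2 → Finset k) : Prop :=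
  ∀ i j, i ≠ j → ∀ a ∈ A i,
    (slice i a p).natDegree = p.degreeOf j ∧ slice i a p ∣ rootPoly (A j)

variable {K : Type*} [Field K] [Algebra k K] {Γ : Type*} [LinearOrderedCommGroupWithZero Γ]
  (v : Valuation K Γ)

lemma aeval_slice {i j : Fin 2} (hij : i ≠ j) (a : k) (p : MvPolynomial (Fin 2) k) (x : K) :
    Polynomial.aeval x (slice i a p) =
      ∑ m ∈ p.support, algebraMap k K (p.coeff m) * (algebraMap k K a ^ m i * x ^ m j) := by
  rw [slice, aeval_eq_sum_of_ne p hij, map_sum]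
  simp [hij.symm]

lemma valuation_pow_sub_pow_le {x y : K} (hx : v x ≤ 1) (hy : v y ≤ 1) (n : ℕ) :
    v (x ^ n - y ^ n) ≤ v (x - y) := by
  obtain ⟨c, hc⟩ := sub_dvd_pow_sub_pow (⟨x, hx⟩ : v.integer) ⟨y, hy⟩ n
  have hc' : x ^ n - y ^ n = (x - y) * c := congrArg Subtype.val hc
  rw [hc', map_mul]
  exact mul_le_of_le_one_right' c.2

variable [v.IsTrivialOn k]

lemma valuation_algebraMap_le_one (c : k) : v (algebraMap k K c) ≤ 1 := by
  by_cases h : c = 0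
  · simp [h]
  · exact (Valuation.IsTrivialOn.eq_one c h).le

lemma valuation_aeval_le_one {x : K} (hx : v x ≤ 1) (f : Polynomial k) :
    v (Polynomial.aeval x f) ≤ 1 := by
  rw [Polynomial.aeval_eq_sum_range]
  refine v.map_sum_le fun n _ => ?_
  rw [Algebra.smul_def, map_mul, map_pow]
  exact mul_le_one' (valuation_algebraMap_le_one v _) (pow_le_one' hx _)

lemma valuation_aeval_le_of_dvd {x : K} (hx : v x ≤ 1) {f g : Polynomial k} (h : f ∣ g) :
    v (Polynomial.aeval x g) ≤ v (Polynomial.aeval x f) := by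
  obtain ⟨q, rfl⟩ := h
  rw [map_mul, map_mul]
  exact mul_le_of_le_one_right' (valuation_aeval_le_one v hx q)

variable {p : MvPolynomial (Fin 2) k} {A : Fin 2 → Finset k} {t : Fin 2 → K}

/-- If `t i` reduces to some `a` in `A i`, then p(a, t j) = p(a, t j) − p(t i, t j) is a multiple of
`t i` − `a` in the valuation ring, and p(a, ·) divides the root polynomial of `A j`. Otherwise the
right side is at least 1. Exchanging `i` and `j` gives equality. -/
lemma valuation_rootPoly_le (hA : IsRegularPair p A) (ht : MvPolynomial.aeval t p = 0)
    (h : ∀ l, v (t l) ≤ 1) {i j : Fin 2} (hij : i ≠ j) :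
    v (Polynomial.aeval (t j) (rootPoly (A j))) ≤ v (Polynomial.aeval (t i) (rootPoly (A i))) := by
  by_cases hex : ∃ a ∈ A i, v (t i - algebraMap k K a) < 1
  · obtain ⟨a, ha, hlt⟩ := hex
    -- The other factors are units, since `t i` reduces to only one constant.
    have hother : v (Polynomial.aeval (t i) (rootPoly (A i))) = v (t i - algebraMap k K a) := by
      rw [rootPoly, map_prod, map_prod, Finset.prod_eq_single_of_mem a ha]
      · simp
      · intro b _ hb
        have h1 : v (algebraMap k K (a - b)) = 1 :=
          Valuation.IsTrivialOn.eq_one _ (sub_ne_zero.2 hb.symm)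
        have h2 : Polynomial.aeval (t i) (Polynomial.X - Polynomial.C b) =
            (t i - algebraMap k K a) + algebraMap k K (a - b) := by simp
        rw [h2, Valuation.map_add_eq_of_lt_right v (by rwa [h1]), h1]
    rw [hother]
    refine (valuation_aeval_le_of_dvd v (h j) (hA i j hij a ha).2).trans ?_
    have e : Polynomial.aeval (t j) (slice i a p) = - (∑ m ∈ p.support,
        algebraMap k K (p.coeff m) * ((t i ^ m i - algebraMap k K a ^ m i) * t j ^ m j)) := by
      rw [aeval_slice hij, ← sub_eq_zero, sub_neg_eq_add, ← Finset.sum_add_distrib, ← ht,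
        aeval_eq_sum_of_ne p hij]
      exact Finset.sum_congr rfl fun m _ => by ring
    rw [e, Valuation.map_neg]
    refine v.map_sum_le fun m _ => ?_
    rw [map_mul, map_mul, map_pow]
    refine mul_le_of_le_one_of_le (valuation_algebraMap_le_one v _) ?_
    refine mul_le_of_le_of_le_one ?_ (pow_le_one' (h j) _)
    exact valuation_pow_sub_pow_le v (h i) (valuation_algebraMap_le_one v a) _
  · push Not at hex
    refine (valuation_aeval_le_one v (h j) _).trans ?_
    rw [rootPoly, map_prod, map_prod]
    exact Finset.one_le_prod' fun a ha => by simpa using hex a ha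

lemma valuation_rootPoly_of_one_lt {x : K} (hx : 1 < v x) (A : Finset k) :
    v (Polynomial.aeval x (rootPoly A)) = v x ^ A.card := by
  rw [Polynomial.valuation_aeval_eq_valuation_X_pow_natDegree_of_one_lt_valuation_X x hx
    (rootPoly_monic A).ne_zero, natDegree_rootPoly]

/-- No point over a value in `A j` lies at infinity. If `t j` reduced to `b` in `A j`, the slice at
`b`, of full degree, would have value v(t i)^deg at the pole `t i`, while p(t) = 0 would make that
value strictly smaller. -/
lemma valuation_rootPoly_eq_one (hA : IsRegularPair p A) (hp : ∀ l, 0 < p.degreeOf l)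
    (ht : MvPolynomial.aeval t p = 0) {i j : Fin 2} (hij : i ≠ j)
    (hi : 1 < v (t i)) (hj : v (t j) ≤ 1) :
    v (Polynomial.aeval (t j) (rootPoly (A j))) = 1 := by
  rw [rootPoly, map_prod, map_prod]
  refine Finset.prod_eq_one fun b hb => ?_
  rw [map_sub, Polynomial.aeval_X, Polynomial.aeval_C]
  have hle : v (t j - algebraMap k K b) ≤ 1 :=
    (v.map_sub _ _).trans (max_le hj (valuation_algebraMap_le_one v b))
  refine le_antisymm hle ?_
  have hdeg := (hA j i hij.symm b hb).1
  have hne : slice j b p ≠ 0 := by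
    intro h0
    rw [h0, Polynomial.natDegree_zero] at hdeg
    exact (hp i).ne hdeg
  have e : Polynomial.aeval (t i) (slice j b p) = - (∑ m ∈ p.support,
      algebraMap k K (p.coeff m) * ((t j ^ m j - algebraMap k K b ^ m j) * t i ^ m i)) := by
    rw [aeval_slice hij.symm, ← sub_eq_zero, sub_neg_eq_add, ← Finset.sum_add_distrib, ← ht,
      aeval_eq_sum_of_ne p hij.symm]
    exact Finset.sum_congr rfl fun m _ => by ring
  have h1 : v (t i) ^ p.degreeOf i ≤ v (t j - algebraMap k K b) * v (t i) ^ p.degreeOf i := by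
    conv_lhs => rw [← hdeg, ← Polynomial.valuation_aeval_eq_valuation_X_pow_natDegree_of_one_lt_valuation_X
      _ hi hne, e, Valuation.map_neg]
    refine v.map_sum_le fun m hm => ?_
    rw [map_mul, map_mul, map_pow]
    refine mul_le_of_le_one_of_le (valuation_algebraMap_le_one v _) ?_
    refine mul_le_mul' (valuation_pow_sub_pow_le v hj (valuation_algebraMap_le_one v b) _) ?_
    exact pow_le_pow_right₀ hi.le (MvPolynomial.degreeOf_le_iff.1 le_rfl m hm)
  have hpos : 0 < v (t i) ^ p.degreeOf i := pow_pos (zero_lt_one.trans hi) _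
  by_contra hlt
  exact absurd h1 (not_le.2 (mul_lt_of_lt_one_left hpos (not_le.1 hlt)))

end Valuations

/-! ### Double counting the points over a regular pair. -/

section Counting

variable {k : Type*} [Field k]

open scoped Classical in
lemma card_roots_slice {p : MvPolynomial (Fin 2) k} {A : Fin 2 → Finset k}
    (hA : IsRegularPair p A) (hp : ∀ l, 0 < p.degreeOf l) {i j : Fin 2} (hij : i ≠ j) {a : k}
    (ha : a ∈ A i) : {b ∈ A j | (slice i a p).eval b = 0}.card = p.degreeOf j := by
  obtain ⟨hdeg, hdvd⟩ := hA i j hij a ha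
  have hne : slice i a p ≠ 0 := by
    intro h0
    rw [h0, Polynomial.natDegree_zero] at hdeg
    exact (hp j).ne hdeg
  have hsplits : (rootPoly (A j)).Splits :=
    Polynomial.Splits.prod fun _ _ => Polynomial.Splits.X_sub_C _
  have hsep : (rootPoly (A j)).Separable :=
    Polynomial.separable_prod_X_sub_C_iff'.2 fun _ _ _ _ h => h
  have h1 := hsplits.of_dvd (rootPoly_monic _).ne_zero hdvd
  have h2 := Polynomial.nodup_roots (hsep.of_dvd hdvd)
  rw [← hdeg, h1.natDegree_eq_card_roots, ← Multiset.toFinset_card_of_nodup h2]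
  congr 1
  ext b
  simp only [Finset.mem_filter, Multiset.mem_toFinset, Polynomial.mem_roots hne,
    Polynomial.IsRoot.def, and_iff_right_iff_imp]
  intro hb
  rw [← eval_rootPoly_eq_zero_iff]
  exact Polynomial.eval_eq_zero_of_dvd_of_eval_eq_zero hdvd hb

lemma slice_eval_comm {i j : Fin 2} (hij : i ≠ j) (a b : k) (p : MvPolynomial (Fin 2) k) :
    (slice i a p).eval b = (slice j b p).eval a := by
  have h := slice_eval hij a (fun l => if l = i then a else b) (by simp) p
  have h' := slice_eval hij.symm b (fun l => if l = i then a else b) (by simp [hij.symm]) p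
  simp only [if_true, hij.symm, if_false] at h h'
  rw [h, h']

/-- Count the points of the curve over the pair along each projection; every fibre has exactly the
full degree, being separable and split. -/
lemma card_mul_degreeOf_eq {p : MvPolynomial (Fin 2) k} {A : Fin 2 → Finset k}
    (hA : IsRegularPair p A) (hp : ∀ l, 0 < p.degreeOf l) :
    (A 0).card * p.degreeOf 1 = (A 1).card * p.degreeOf 0 := by
  classical
  have h01 : (0 : Fin 2) ≠ 1 := by decide
  refine Finset.card_mul_eq_card_mul (fun a b => (slice 0 a p).eval b = 0) (fun a ha => ?_)
    (fun b hb => ?_)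
  · exact card_roots_slice hA hp h01 ha
  · rw [← card_roots_slice hA hp h01.symm hb]
    simp only [Finset.bipartiteBelow, slice_eval_comm h01]

end Counting

/-! ### Functions without zeros and poles; the separated multiple of `p`. -/

section Constants

variable {k : Type*} [Field k]

/-- An element of an extension of an algebraically closed field that lies in all valuation rings
containing that field is a constant. -/
lemma exists_algebraMap_eq_of_valuation_le_one [IsAlgClosed k] {K : Type*} [Field K] [Algebra k K]
    {u : K} (h : ∀ V : ValuationSubring K, V.valuation.IsTrivialOn k → V.valuation u ≤ 1) :
    ∃ c, algebraMap k K c = u := by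
  -- The intersection of the valuation rings containing k is the integral closure of k in `K`, which
  -- is k as k is algebraically closed.
  have hmem : u ∈ ⨅ V : {V : ValuationSubring K // ((algebraMap k K).range : Set K) ⊆ V.toSubring},
      V.1.toSubring := by
    rw [Subring.mem_iInf]
    rintro ⟨V, hV⟩
    change u ∈ V
    rw [← V.valuation_le_one_iff]
    have hle : ∀ c : k, V.valuation (algebraMap k K c) ≤ 1 := fun c =>
      (V.valuation_le_one_iff _).2 (hV ⟨c, rfl⟩)
    refine h V ⟨fun c hc => le_antisymm (hle c) ?_⟩
    have h2 := hle c⁻¹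
    rw [map_inv₀, map_inv₀] at h2
    have h3 : V.valuation (algebraMap k K c) ≠ 0 := by simpa using hc
    exact (inv_le_one₀ (zero_lt_iff.2 h3)).1 h2
  rw [iInf_valuationSubring_superset, Subring.closure_eq] at hmem
  have hint : IsIntegral (algebraMap k K).range u := hmem
  let _ : Algebra k (algebraMap k K).range := (algebraMap k K).rangeRestrict.toAlgebra
  have : IsScalarTower k (algebraMap k K).range K := .of_algebraMap_eq fun _ => rfl
  have : Algebra.IsIntegral k (algebraMap k K).range :=
    Algebra.isIntegral_of_surjective (algebraMap k K).rangeRestrict_surjective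
  have hk : IsIntegral k u := isIntegral_trans (R := k) (A := (algebraMap k K).range) u hint
  exact hk.mem_range_algebraMap_of_minpoly_splits (IsAlgClosed.splits _)

lemma degreeOf_aeval_X_of_ne {i j : Fin 2} (hij : i ≠ j) (f : Polynomial k) :
    (Polynomial.aeval (MvPolynomial.X i : MvPolynomial (Fin 2) k) f).degreeOf j = 0 := by
  rw [Polynomial.aeval_eq_sum_range, ← Nat.le_zero]
  refine (MvPolynomial.degreeOf_sum_le _ _ _).trans (Finset.sup_le fun n _ => ?_)
  rw [MvPolynomial.smul_eq_C_mul]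
  refine (MvPolynomial.degreeOf_C_mul_le _ _ _).trans ?_
  refine (MvPolynomial.degreeOf_pow_le _ _ _).trans ?_
  simp [MvPolynomial.degreeOf_X, hij.symm]

/-- A multiple of `p` has positive degree in both variables. Hence each coordinate is transcendental
on the curve. -/
lemma not_dvd_aeval_X {p : MvPolynomial (Fin 2) k} (hp : ∀ l, 0 < p.degreeOf l) (i : Fin 2)
    {f : Polynomial k} (hf : f ≠ 0) : ¬ p ∣ Polynomial.aeval (MvPolynomial.X i : MvPolynomial (Fin 2) k) f := by
  rintro ⟨q, hq⟩
  obtain ⟨j, hij⟩ := exists_ne i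
  have hne : Polynomial.aeval (MvPolynomial.X i : MvPolynomial (Fin 2) k) f ≠ 0 := by
    exact fun h => hf (transcendental_iff.1 (MvPolynomial.transcendental_X k i) f h)
  have h1 := congrArg (MvPolynomial.degreeOf j) hq
  have hp0 : p ≠ 0 := by rintro rfl; simp at hp
  have hq0 : q ≠ 0 := by rintro rfl; simp [hne] at hq
  rw [MvPolynomial.degreeOf_mul_eq hp0 hq0] at h1
  have h2 := degreeOf_aeval_X_of_ne hij.symm f
  have := hp j
  omega

variable {p : MvPolynomial (Fin 2) k} {A A' : Fin 2 → Finset k}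

/-- The four cases are which coordinates have a pole. At finite places each pair balances by itself;
the exponents are chosen so that the pole orders of the two pairs cancel in the other cases, in the
second coordinate by `card_mul_degreeOf_eq`. -/
lemma valuation_rootPoly_mul_eq (hp : ∀ l, 0 < p.degreeOf l) (hA : IsRegularPair p A)
    (hA' : IsRegularPair p A') {K : Type*} [Field K] [Algebra k K] {Γ : Type*}
    [LinearOrderedCommGroupWithZero Γ] (v : Valuation K Γ) [v.IsTrivialOn k] {t : Fin 2 → K}
    (ht : MvPolynomial.aeval t p = 0) :
    v (Polynomial.aeval (t 1) (rootPoly (A 1))) ^ ((A' 0).card * p.degreeOf 1) *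
      v (Polynomial.aeval (t 0) (rootPoly (A' 0))) ^ ((A 0).card * p.degreeOf 1) =
    v (Polynomial.aeval (t 0) (rootPoly (A 0))) ^ ((A' 0).card * p.degreeOf 1) *
      v (Polynomial.aeval (t 1) (rootPoly (A' 1))) ^ ((A 0).card * p.degreeOf 1) := by
  have h01 : (0 : Fin 2) ≠ 1 := by decide
  rcases le_or_gt (v (t 0)) 1 with h0 | h0 <;> rcases le_or_gt (v (t 1)) 1 with h1 | h1
  · have h : ∀ l, v (t l) ≤ 1 := Fin.forall_fin_two.2 ⟨h0, h1⟩
    rw [le_antisymm (valuation_rootPoly_le v hA ht h h01) (valuation_rootPoly_le v hA ht h h01.symm),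
      le_antisymm (valuation_rootPoly_le v hA' ht h h01)
        (valuation_rootPoly_le v hA' ht h h01.symm)]
  · rw [valuation_rootPoly_eq_one v hA hp ht h01.symm h1 h0,
      valuation_rootPoly_eq_one v hA' hp ht h01.symm h1 h0, valuation_rootPoly_of_one_lt v h1,
      valuation_rootPoly_of_one_lt v h1, one_pow, one_pow, one_mul, mul_one, ← pow_mul, ← pow_mul,
      card_mul_degreeOf_eq hA hp, card_mul_degreeOf_eq hA' hp]
    congr 1; ring
  · rw [valuation_rootPoly_eq_one v hA hp ht h01 h0 h1,
      valuation_rootPoly_eq_one v hA' hp ht h01 h0 h1, valuation_rootPoly_of_one_lt v h0,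
      valuation_rootPoly_of_one_lt v h0, one_pow, one_pow, one_mul, mul_one, ← pow_mul, ← pow_mul]
    congr 1; ring
  · rw [valuation_rootPoly_of_one_lt v h0, valuation_rootPoly_of_one_lt v h1,
      valuation_rootPoly_of_one_lt v h0, valuation_rootPoly_of_one_lt v h1, mul_comm]
    simp only [← pow_mul]
    congr 2
    · ring
    · rw [card_mul_degreeOf_eq hA hp, card_mul_degreeOf_eq hA' hp]; ring

/-- Two regular pairs give rise to a separated multiple of `p`. -/
theorem exists_dvd_separated [IsAlgClosed k] (hirr : Irreducible p) (hp : ∀ l, 0 < p.degreeOf l)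
    (hA : IsRegularPair p A) (hA' : IsRegularPair p A') :
    ∃ c : k, c ≠ 0 ∧ p ∣
      Polynomial.aeval (MvPolynomial.X 1) (rootPoly (A 1)) ^ ((A' 0).card * p.degreeOf 1) *
        Polynomial.aeval (MvPolynomial.X 0) (rootPoly (A' 0)) ^ ((A 0).card * p.degreeOf 1) -
      MvPolynomial.C c *
        (Polynomial.aeval (MvPolynomial.X 0) (rootPoly (A 0)) ^ ((A' 0).card * p.degreeOf 1) *
          Polynomial.aeval (MvPolynomial.X 1) (rootPoly (A' 1)) ^ ((A 0).card * p.degreeOf 1)) := by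
  have hprime : (Ideal.span {p}).IsPrime :=
    (Ideal.span_singleton_prime hirr.ne_zero).2 hirr.prime
  let R := MvPolynomial (Fin 2) k ⧸ Ideal.span {p}
  let K := FractionRing R
  let t : Fin 2 → K := fun i => algebraMap R K (Ideal.Quotient.mk _ (MvPolynomial.X i))
  have hker : ∀ q : MvPolynomial (Fin 2) k, MvPolynomial.aeval t q = 0 ↔ p ∣ q := by
    intro q
    have e : MvPolynomial.aeval t q = algebraMap R K (Ideal.Quotient.mk _ q) := by
      have : MvPolynomial.aeval t = (IsScalarTower.toAlgHom k R K).comp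
          (Ideal.Quotient.mkₐ k (Ideal.span {p})) := by
        apply MvPolynomial.algHom_ext
        intro i
        simp only [MvPolynomial.aeval_X, t]
        rfl
      rw [this]; rfl
    rw [e, map_eq_zero_iff _ (IsFractionRing.injective R K), Ideal.Quotient.eq_zero_iff_mem,
      Ideal.mem_span_singleton]
  have ht := (hker p).2 dvd_rfl
  have hX : ∀ (i : Fin 2) (f : Polynomial k), MvPolynomial.aeval t
      (Polynomial.aeval (MvPolynomial.X i : MvPolynomial (Fin 2) k) f) =
      Polynomial.aeval (t i) f := by
    intro i f
    rw [← Polynomial.aeval_algHom_apply, MvPolynomial.aeval_X]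
  have hne : ∀ (i : Fin 2) (B : Finset k), Polynomial.aeval (t i) (rootPoly B) ≠ 0 := by
    intro i B
    rw [← hX, Ne, hker]
    exact not_dvd_aeval_X hp i (rootPoly_monic B).ne_zero
  set α := (A' 0).card * p.degreeOf 1 with hα
  set β := (A 0).card * p.degreeOf 1 with hβ
  set N : K := Polynomial.aeval (t 1) (rootPoly (A 1)) ^ α *
    Polynomial.aeval (t 0) (rootPoly (A' 0)) ^ β with hN
  set D : K := Polynomial.aeval (t 0) (rootPoly (A 0)) ^ α *
    Polynomial.aeval (t 1) (rootPoly (A' 1)) ^ β with hD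
  have hN0 : N ≠ 0 := mul_ne_zero (pow_ne_zero _ (hne _ _)) (pow_ne_zero _ (hne _ _))
  have hD0 : D ≠ 0 := mul_ne_zero (pow_ne_zero _ (hne _ _)) (pow_ne_zero _ (hne _ _))
  obtain ⟨c, hc⟩ := exists_algebraMap_eq_of_valuation_le_one (k := k) (u := N / D) (by
    intro V hV
    have h := valuation_rootPoly_mul_eq hp hA hA' V.valuation ht
    have h' : V.valuation N = V.valuation D := by simpa [hN, hD] using h
    rw [map_div₀, h', div_self ((Valuation.ne_zero_iff _).2 hD0)])
  refine ⟨c, ?_, ?_⟩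
  · rintro rfl
    rw [map_zero] at hc
    exact div_ne_zero hN0 hD0 hc.symm
  · rw [← hker]
    simp only [map_sub, map_mul, map_pow, hX, MvPolynomial.aeval_C]
    rw [hc, ← hN, ← hD, div_mul_cancel₀ _ hD0, sub_self]

end Constants

/-! ### From the affine divisibility to a relation on the whole projective curve. -/

section Homogenization

variable {k : Type*} [Field k] {R : Type*} [CommRing R] [Algebra k R]

/-- The value of the homogenization of `s` of bidegree `(M, N)`. -/
def homEval (M N : ℕ) (s : MvPolynomial (Fin 2) k) (v w : Fin 2 → R) : R :=
  ∑ m ∈ s.support, algebraMap k R (s.coeff m) *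
    ((v 0 ^ (M - m 0) * v 1 ^ m 0) * (w 0 ^ (N - m 1) * w 1 ^ m 1))

/-- The binary form with simple roots at the points of a finite set. -/
def rootForm (A : Finset k) (v : Fin 2 → R) : R := ∏ a ∈ A, (v 1 - algebraMap k R a * v 0)

lemma map_homEval {S : Type*} [CommRing S] [Algebra k S] (φ : R →ₐ[k] S) (M N : ℕ)
    (s : MvPolynomial (Fin 2) k) (v w : Fin 2 → R) :
    φ (homEval M N s v w) = homEval M N s (φ ∘ v) (φ ∘ w) := by
  simp [homEval]

lemma map_rootForm {S : Type*} [CommRing S] [Algebra k S] (φ : R →ₐ[k] S) (A : Finset k)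
    (v : Fin 2 → R) : φ (rootForm A v) = rootForm A (φ ∘ v) := by
  simp [rootForm]

lemma biEval_eq_homEval (p : MvPolynomial (Fin 2) k) (v w : Fin 2 → k) :
    biEval p v w = homEval (p.degreeOf 0) (p.degreeOf 1) p v w := by
  simp [biEval_eq, homEval]

lemma homEval_eq_eval {M N : ℕ} {s : MvPolynomial (Fin 2) k} (hM : s.degreeOf 0 ≤ M)
    (hN : s.degreeOf 1 ≤ N) {v w : Fin 2 → k} (hv : v 0 ≠ 0) (hw : w 0 ≠ 0) :
    homEval M N s v w =
      v 0 ^ M * w 0 ^ N * MvPolynomial.eval ![v 1 / v 0, w 1 / w 0] s := by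
  rw [homEval, MvPolynomial.eval_eq', Finset.mul_sum]
  refine Finset.sum_congr rfl fun m hm => ?_
  have h0 := MvPolynomial.degreeOf_le_iff.1 hM m hm
  have h1 := MvPolynomial.degreeOf_le_iff.1 hN m hm
  obtain ⟨r, rfl⟩ := Nat.exists_eq_add_of_le h0
  obtain ⟨l, rfl⟩ := Nat.exists_eq_add_of_le h1
  simp only [Fin.prod_univ_two, Nat.add_sub_cancel_left, Algebra.algebraMap_self_apply]
  simp only [Matrix.cons_val_zero, Matrix.cons_val_one, pow_add, div_pow]
  field_simp

lemma rootForm_eq_eval (A : Finset k) {v : Fin 2 → k} (hv : v 0 ≠ 0) :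
    rootForm A v = v 0 ^ A.card * (rootPoly A).eval (v 1 / v 0) := by
  rw [rootForm, rootPoly, Polynomial.eval_prod, ← Finset.prod_const, ← Finset.prod_mul_distrib]
  refine Finset.prod_congr rfl fun a _ => ?_
  simp
  field_simp

/-- Multiplying by the linear factors that vanish at the two excluded values gives a polynomial that
is zero everywhere. -/
lemma eq_zero_of_eval_eq_zero [Infinite k] (G : Polynomial k) (a b : k)
    (h : ∀ T, a + T ≠ 0 → b + T ≠ 0 → G.eval T = 0) : G = 0 := by
  have h2 : (Polynomial.X + Polynomial.C a) * ((Polynomial.X + Polynomial.C b) * G) = 0 := by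
    refine Polynomial.funext fun T => ?_
    by_cases ha : a + T = 0
    · simp [add_comm T a, ha]
    by_cases hb : b + T = 0
    · simp [add_comm T b, hb]
    simp [h T ha hb]
  simpa [Polynomial.X_add_C_ne_zero] using h2

lemma degreeOf_aeval_X_le (i : Fin 2) (f : Polynomial k) :
    (Polynomial.aeval (MvPolynomial.X i : MvPolynomial (Fin 2) k) f).degreeOf i ≤ f.natDegree := by
  rw [Polynomial.aeval_eq_sum_range]
  refine (MvPolynomial.degreeOf_sum_le _ _ _).trans (Finset.sup_le fun n hn => ?_)
  rw [MvPolynomial.smul_eq_C_mul]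
  refine (MvPolynomial.degreeOf_C_mul_le _ _ _).trans ?_
  refine (MvPolynomial.degreeOf_pow_le _ _ _).trans ?_
  rw [Finset.mem_range] at hn
  simp
  omega

/-- A separated multiple of `p` gives, after homogenization, a relation between the coordinates of
all points of the curve, also at infinity. -/
lemma rootForm_relation [Infinite k] {p : MvPolynomial (Fin 2) k} {A₀ A₁ B₀ B₁ : Finset k}
    {α β : ℕ} {c : k} (h0 : A₀.card * α = B₀.card * β) (h1 : A₁.card * α = B₁.card * β)
    (hdvd : p ∣ Polynomial.aeval (MvPolynomial.X 1) (rootPoly A₁) ^ α *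
        Polynomial.aeval (MvPolynomial.X 0) (rootPoly B₀) ^ β -
      MvPolynomial.C c * (Polynomial.aeval (MvPolynomial.X 0) (rootPoly A₀) ^ α *
        Polynomial.aeval (MvPolynomial.X 1) (rootPoly B₁) ^ β))
    {v w : Fin 2 → k} (hvw : biEval p v w = 0) :
    rootForm A₁ w ^ α * rootForm B₀ v ^ β = c * (rootForm A₀ v ^ α * rootForm B₁ w ^ β) := by
  obtain ⟨s, hs⟩ := hdvd
  set Q := Polynomial.aeval (MvPolynomial.X 1 : MvPolynomial (Fin 2) k) (rootPoly A₁) ^ α *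
        Polynomial.aeval (MvPolynomial.X 0) (rootPoly B₀) ^ β -
      MvPolynomial.C c * (Polynomial.aeval (MvPolynomial.X 0) (rootPoly A₀) ^ α *
        Polynomial.aeval (MvPolynomial.X 1) (rootPoly B₁) ^ β) with hQ
  have hdeg : ∀ (i j : Fin 2), i ≠ j → ∀ (A B : Finset k) (m n : ℕ),
      (Polynomial.aeval (MvPolynomial.X i : MvPolynomial (Fin 2) k) (rootPoly A) ^ m *
        Polynomial.aeval (MvPolynomial.X j) (rootPoly B) ^ n).degreeOf i ≤ A.card * m := by
    intro i j hij A B m n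
    refine (MvPolynomial.degreeOf_mul_le _ _ _).trans ?_
    have e1 := MvPolynomial.degreeOf_pow_le i
      (Polynomial.aeval (MvPolynomial.X i : MvPolynomial (Fin 2) k) (rootPoly A)) m
    have e2 := MvPolynomial.degreeOf_pow_le i
      (Polynomial.aeval (MvPolynomial.X j : MvPolynomial (Fin 2) k) (rootPoly B)) n
    have e3 := degreeOf_aeval_X_le i (rootPoly A)
    rw [natDegree_rootPoly] at e3
    rw [degreeOf_aeval_X_of_ne hij.symm, mul_zero] at e2
    have e4 := Nat.mul_le_mul_left m e3
    rw [mul_comm A.card]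
    omega
  have h01 : (0 : Fin 2) ≠ 1 := by decide
  -- By `h0` and `h1` both terms of `Q` fit in one bidegree (`M`, `N`), so their homogenizations are
  -- comparable.
  have hQ0 : Q.degreeOf 0 ≤ A₀.card * α := by
    refine (MvPolynomial.degreeOf_sub_le _ _ _).trans (max_le ?_ ?_)
    · rw [mul_comm (_ ^ α), h0]
      exact hdeg 0 1 h01 _ _ _ _
    · exact (MvPolynomial.degreeOf_C_mul_le _ _ _).trans (hdeg 0 1 h01 _ _ _ _)
  have hQ1 : Q.degreeOf 1 ≤ A₁.card * α := by
    refine (MvPolynomial.degreeOf_sub_le _ _ _).trans (max_le ?_ ?_)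
    · exact hdeg 1 0 h01.symm _ _ _ _
    · refine (MvPolynomial.degreeOf_C_mul_le _ _ _).trans ?_
      rw [mul_comm (_ ^ α), h1]
      exact hdeg 1 0 h01.symm _ _ _ _
  set M := A₀.card * α
  set N := A₁.card * α
  -- The relation with an error term on the affine chart.
  have haff : ∀ v w : Fin 2 → k, v 0 ≠ 0 → w 0 ≠ 0 →
      rootForm A₁ w ^ α * rootForm B₀ v ^ β - c * (rootForm A₀ v ^ α * rootForm B₁ w ^ β) =
        homEval (p.degreeOf 0) (p.degreeOf 1) p v w *
          homEval (M - p.degreeOf 0) (N - p.degreeOf 1) s v w := by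
    intro v w hv hw
    have hL : rootForm A₁ w ^ α * rootForm B₀ v ^ β -
        c * (rootForm A₀ v ^ α * rootForm B₁ w ^ β) =
        v 0 ^ M * w 0 ^ N * MvPolynomial.eval ![v 1 / v 0, w 1 / w 0] Q := by
      have hev : ∀ (i : Fin 2) (f : Polynomial k), MvPolynomial.eval ![v 1 / v 0, w 1 / w 0]
          (Polynomial.aeval (MvPolynomial.X i : MvPolynomial (Fin 2) k) f) =
          f.eval (![v 1 / v 0, w 1 / w 0] i) := by
        intro i f
        rw [← MvPolynomial.coe_aeval_eq_eval, RingHom.coe_coe, ← Polynomial.aeval_algHom_apply,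
          MvPolynomial.aeval_X, Polynomial.coe_aeval_eq_eval]
      simp only [hQ, map_sub, map_mul, map_pow, hev, MvPolynomial.eval_C,
        rootForm_eq_eval _ hv, rootForm_eq_eval _ hw, mul_pow, ← pow_mul]
      rw [← h0, ← h1]
      simp only [Matrix.cons_val_zero, Matrix.cons_val_one]
      ring
    rw [hL]
    by_cases hs0 : s = 0
    · simp [hs, hs0, homEval]
    by_cases hp0 : p = 0
    · simp [hs, hp0, homEval]
    rw [hs, MvPolynomial.degreeOf_mul_eq hp0 hs0] at hQ0 hQ1
    rw [homEval_eq_eval le_rfl le_rfl hv hw, homEval_eq_eval (by omega) (by omega) hv hw, hs,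
      map_mul]
    have eM : M = p.degreeOf 0 + (M - p.degreeOf 0) := by omega
    have eN : N = p.degreeOf 1 + (N - p.degreeOf 1) := by omega
    conv_lhs => rw [eM, eN, pow_add, pow_add]
    ring
  -- Points at infinity are reached by deformation: shift `v 0` and `w 0` by a parameter T. The
  -- identity `haff` holds for all but at most two T, hence as polynomials in T, hence at T = 0.
  let V : Fin 2 → Polynomial k := ![Polynomial.C (v 0) + Polynomial.X, Polynomial.C (v 1)]
  let W : Fin 2 → Polynomial k := ![Polynomial.C (w 0) + Polynomial.X, Polynomial.C (w 1)]
  let G : Polynomial k := rootForm A₁ W ^ α * rootForm B₀ V ^ β -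
    Polynomial.C c * (rootForm A₀ V ^ α * rootForm B₁ W ^ β) -
    homEval (p.degreeOf 0) (p.degreeOf 1) p V W *
      homEval (M - p.degreeOf 0) (N - p.degreeOf 1) s V W
  have hG : ∀ T, G.eval T = rootForm A₁ ![w 0 + T, w 1] ^ α * rootForm B₀ ![v 0 + T, v 1] ^ β -
      c * (rootForm A₀ ![v 0 + T, v 1] ^ α * rootForm B₁ ![w 0 + T, w 1] ^ β) -
      homEval (p.degreeOf 0) (p.degreeOf 1) p ![v 0 + T, v 1] ![w 0 + T, w 1] *
      homEval (M - p.degreeOf 0) (N - p.degreeOf 1) s ![v 0 + T, v 1] ![w 0 + T, w 1] := by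
    intro T
    have hV : Polynomial.aeval T ∘ V = ![v 0 + T, v 1] := by
      funext l; fin_cases l <;> simp [V]
    have hW : Polynomial.aeval T ∘ W = ![w 0 + T, w 1] := by
      funext l; fin_cases l <;> simp [W]
    rw [← Polynomial.coe_aeval_eq_eval]
    simp only [G, map_sub, map_mul, map_pow, map_rootForm, map_homEval, hV, hW,
      Polynomial.aeval_C, Algebra.algebraMap_self_apply]
  have hG0 : G = 0 := by
    refine eq_zero_of_eval_eq_zero G (v 0) (w 0) fun T h1 h2 => ?_
    rw [hG, haff _ _ (by simpa using h1) (by simpa using h2), sub_self]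
  have h := hG 0
  have ev : ∀ u : Fin 2 → k, ![u 0 + 0, u 1] = u := by
    intro u; funext l; fin_cases l <;> simp
  rw [hG0, Polynomial.eval_zero, ev, ev, ← biEval_eq_homEval, hvw, zero_mul, sub_zero] at h
  exact (sub_eq_zero.1 h.symm)

end Homogenization

/-! ### Stabilization of iterates inside bounded fibres. -/

section IteratedRelation

variable {X Y : Type*}

lemma iter_subset_iter_succ {R : SetRel X X} (hR : ∀ x, (x, x) ∈ R) (n : ℕ) :
    iter R n ⊆ iter R (n + 1) := fun ⟨_, b⟩ h => ⟨b, h, hR b⟩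

/-- A reflexive relation that is contained in the kernel of a map with fibres of bounded size has
stationary iterates. -/
lemma iter_eq_iter_succ {R : SetRel X X} (hR : ∀ x, (x, x) ∈ R) (F : X → Y)
    (hF : ∀ x y, (x, y) ∈ R → F x = F y) (N : ℕ)
    (hN : ∀ e, {x | F x = e}.Finite ∧ {x | F x = e}.ncard ≤ N) :
    iter R N = iter R (N + 1) := by
  have hiter : ∀ n x y, (x, y) ∈ iter R n → F x = F y := by
    intro n
    induction n with
    | zero => rintro x y h; exact congrArg F h
    | succ n ih => rintro x y ⟨b, h1, h2⟩; exact (ih x b h1).trans (hF b y h2)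
  let S : X → ℕ → Set X := fun x n => {y | (x, y) ∈ iter R n}
  have hS : ∀ x n, S x n ⊆ {y | F y = F x} := fun x n y h => (hiter n x y h).symm
  have hmono : ∀ x n, S x n ⊆ S x (n + 1) := fun x n y h => iter_subset_iter_succ hR n h
  have hstab : ∀ x n, S x n = S x (n + 1) → S x (n + 1) = S x (n + 2) := by
    intro x n h
    ext y
    constructor
    · exact fun hy => hmono x (n + 1) hy
    · rintro ⟨b, hb, hby⟩
      have : b ∈ S x n := by rw [h]; exact hb
      exact ⟨b, this, hby⟩
  -- Until it is stationary the increasing chain `S x` gains an element at each step, starting from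
  -- the single point x. The bound `N` on the fibres serves all x at once.
  have hgrow : ∀ x n, S x n = S x (n + 1) ∨ n + 2 ≤ (S x (n + 1)).ncard := by
    intro x n
    have hfin : ∀ n, (S x n).Finite := fun n => (hN (F x)).1.subset (hS x n)
    induction n with
    | zero =>
      by_cases h : S x 0 = S x 1
      · exact .inl h
      · right
        have h1 : (S x 0).ncard < (S x 1).ncard :=
          Set.ncard_lt_ncard (ssubset_of_subset_of_ne (hmono x 0) h) (hfin 1)
        have h2 : 0 < (S x 0).ncard := (Set.ncard_pos (hfin 0)).2 ⟨x, rfl⟩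
        change 2 ≤ (S x 1).ncard
        omega
    | succ n ih =>
      rcases ih with h | h
      · exact .inl (hstab x n h)
      · by_cases h' : S x (n + 1) = S x (n + 2)
        · exact .inl h'
        · have := Set.ncard_lt_ncard (ssubset_of_subset_of_ne (hmono x (n + 1)) h') (hfin _)
          right
          omega
  have key : ∀ x, S x N = S x (N + 1) := by
    intro x
    rcases hgrow x N with h | h
    · exact h
    · have := (Set.ncard_le_ncard (hS x (N + 1)) (hN (F x)).1).trans (hN (F x)).2
      omega
  ext ⟨x, y⟩
  exact Set.ext_iff.1 (key x) y

end IteratedRelation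

/-! ### Points of the projective line, and finiteness from two regular pairs. -/

section ProjectiveLine

variable {k : Type*} [Field k]

/-- The point of the projective line with affine coordinate `a`. -/
def affinePoint (a : k) : P1 k := Projectivization.mk k ![1, a] (by simp)

variable (k) in
/-- The point at infinity of the projective line. -/
def infinitePoint : P1 k := Projectivization.mk k ![0, 1] (by simp)

lemma eq_affinePoint_or_eq_infinitePoint (z : P1 k) :
    (∃ a, z = affinePoint a) ∨ z = infinitePoint k := by
  induction z using Projectivization.ind with
  | h v hv =>
    by_cases h : v 0 = 0
    · right
      have h1 : v 1 ≠ 0 := fun h1 => hv (funext fun l => by fin_cases l <;> simp [h, h1])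
      rw [infinitePoint, Projectivization.mk_eq_mk_iff']
      exact ⟨v 1, funext fun l => by fin_cases l <;> simp [h]⟩
    · left
      refine ⟨v 1 / v 0, ?_⟩
      rw [affinePoint, Projectivization.mk_eq_mk_iff']
      refine ⟨v 0, funext fun l => ?_⟩
      fin_cases l
      · simp
      · simp; field_simp

lemma affinePoint_injective : Function.Injective (affinePoint : k → P1 k) := by
  intro a b h
  obtain ⟨s, hs⟩ := (Projectivization.mk_eq_mk_iff' _ _ _ _ _).1 h
  have h0 := congrFun hs 0
  have h1 := congrFun hs 1
  simp at h0 h1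
  simp [← h1, h0]

lemma exists_rep_affinePoint (a : k) : ∃ s : k, s ≠ 0 ∧ (affinePoint a).rep = ![s, s * a] := by
  obtain ⟨s, hs⟩ := Projectivization.exists_smul_eq_mk_rep k ![1, a] (by simp)
  refine ⟨s, s.ne_zero, ?_⟩
  rw [affinePoint, ← hs]
  funext l
  fin_cases l <;> simp [Units.smul_def]

variable {p : MvPolynomial (Fin 2) k}

lemma affinePoint_mem_curve_iff (a b : k) :
    (affinePoint a, affinePoint b) ∈ curve p ↔ MvPolynomial.eval ![a, b] p = 0 := by
  rw [affinePoint, affinePoint, mem_curve_mk, biEval_affine]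

/-- Only monomials of top degree in the second variable survive at infinity, so the curve meets
infinity over `a` exactly when the slice drops degree. -/
lemma biEval_infinite_right (a : k) :
    biEval p ![1, a] ![0, 1] = (slice 0 a p).coeff (p.degreeOf 1) := by
  rw [biEval_eq, slice, aeval_eq_sum_of_ne p (i := 0) (j := 1) (by decide),
    Polynomial.finsetSum_coeff]
  refine Finset.sum_congr rfl fun m hm => ?_
  have h := MvPolynomial.degreeOf_le_iff.1 (le_refl (p.degreeOf 1)) m hm
  rw [Polynomial.algebraMap_apply, Algebra.algebraMap_self_apply, Polynomial.coeff_C_mul]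
  simp only [if_true, one_ne_zero, if_false, ← Polynomial.C_pow, Polynomial.coeff_C_mul,
    Polynomial.coeff_X_pow]
  rcases h.eq_or_lt with h' | h'
  · simp [h']
  · simp [h'.ne', zero_pow (Nat.sub_pos_of_lt h').ne']

lemma biEval_infinite_left (b : k) :
    biEval p ![0, 1] ![1, b] = (slice 1 b p).coeff (p.degreeOf 0) := by
  rw [biEval_eq, slice, aeval_eq_sum_of_ne p (i := 1) (j := 0) (by decide),
    Polynomial.finsetSum_coeff]
  refine Finset.sum_congr rfl fun m hm => ?_
  have h := MvPolynomial.degreeOf_le_iff.1 (le_refl (p.degreeOf 0)) m hm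
  rw [Polynomial.algebraMap_apply, Algebra.algebraMap_self_apply, Polynomial.coeff_C_mul]
  simp only [if_true, zero_ne_one, if_false, ← Polynomial.C_pow, Polynomial.coeff_C_mul,
    Polynomial.coeff_X_pow]
  rcases h.eq_or_lt with h' | h'
  · simp [h']
  · simp [h'.ne', zero_pow (Nat.sub_pos_of_lt h').ne']

/-- Every point of the first projective line lies under a point of the curve. -/
lemma exists_mem_curve [IsAlgClosed k] (hp : 0 < p.degreeOf 1) (z : P1 k) :
    ∃ w, (z, w) ∈ curve p := by
  induction z using Projectivization.ind with
  | h v hv =>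
    let f : Polynomial k := ∑ m ∈ p.support, Polynomial.C (p.coeff m * (v 0 ^ (p.degreeOf 0 - m 0) *
      v 1 ^ m 0)) * Polynomial.X ^ m 1
    have hf : ∀ b, f.eval b = biEval p v ![1, b] := by
      intro b
      simp [f, biEval_eq, Polynomial.eval_finsetSum, mul_assoc]
    have hcoeff : f.coeff (p.degreeOf 1) = biEval p v ![0, 1] := by
      rw [biEval_eq, Polynomial.finsetSum_coeff]
      refine Finset.sum_congr rfl fun m hm => ?_
      have h := MvPolynomial.degreeOf_le_iff.1 (le_refl (p.degreeOf 1)) m hm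
      rw [Polynomial.coeff_C_mul, Polynomial.coeff_X_pow]
      rcases h.eq_or_lt with h' | h'
      · simp [h']
      · simp [h'.ne', zero_pow (Nat.sub_pos_of_lt h').ne']
    by_cases h : biEval p v ![0, 1] = 0
    · exact ⟨infinitePoint k, (mem_curve_mk p _ _ hv _).2 h⟩
    · have hdeg : f.degree ≠ 0 := by
        have := Polynomial.le_natDegree_of_ne_zero (hcoeff ▸ h)
        exact fun h0 => by
          rw [Polynomial.natDegree_eq_zero_iff_degree_le_zero.2 h0.le] at this
          omega
      obtain ⟨b, hb⟩ := IsAlgClosed.exists_root f hdeg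
      refine ⟨affinePoint b, (mem_curve_mk p _ _ hv _).2 ?_⟩
      rw [← hf]; exact hb

lemma roundTrip_refl [IsAlgClosed k] (hp : 0 < p.degreeOf 1) (z : P1 k) :
    (z, z) ∈ roundTrip p := by
  obtain ⟨w, hw⟩ := exists_mem_curve hp z
  exact ⟨w, hw, hw⟩

lemma rootForm_ne_zero_of_disjoint {A B : Finset k} (h : Disjoint A B) (z : P1 k)
    (hz : rootForm A z.rep = 0) : rootForm B z.rep ≠ 0 := by
  intro hz'
  rw [rootForm, Finset.prod_eq_zero_iff] at hz hz'
  obtain ⟨a, ha, hz⟩ := hz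
  obtain ⟨b, hb, hz'⟩ := hz'
  rw [Algebra.algebraMap_self_apply, sub_eq_zero] at hz hz'
  have hne : b ≠ a := fun hab => Finset.disjoint_left.1 h ha (hab ▸ hb)
  have h0 : z.rep 0 = 0 := by
    have : (b - a) * z.rep 0 = 0 := by rw [sub_mul, ← hz, ← hz', sub_self]
    exact (mul_eq_zero.1 this).resolve_left (sub_ne_zero.2 hne)
  refine z.rep_nonzero (funext fun l => ?_)
  fin_cases l
  · exact h0
  · simpa [h0] using hz

/-- A quotient of two root forms with disjoint roots takes each value boundedly often. -/
lemma fibre_rootForm_quotient {A B : Finset k} {α β : ℕ} (hα : α ≠ 0)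
    (hcard : A.card * α = B.card * β) (hA : A.Nonempty) (hAB : Disjoint A B) (e : k) :
    {z : P1 k | rootForm B z.rep ^ β / rootForm A z.rep ^ α = e}.Finite ∧
      {z : P1 k | rootForm B z.rep ^ β / rootForm A z.rep ^ α = e}.ncard ≤
        1 + (A.card + A.card * α) := by
  classical
  -- Away from the poles the fibre over `e` consists of roots of `g`. The poles, where division by
  -- zero gives the value 0, and infinity are simply added to `T`.
  let g : Polynomial k := rootPoly B ^ β - Polynomial.C e * rootPoly A ^ α
  have hg : g ≠ 0 := by
    obtain ⟨a, ha⟩ := hA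
    intro h
    have h1 := congrArg (Polynomial.eval a) h
    simp only [g, Polynomial.eval_sub, Polynomial.eval_pow, Polynomial.eval_mul,
      (eval_rootPoly_eq_zero_iff A a).2 ha, zero_pow hα, mul_zero, sub_zero,
      Polynomial.eval_zero] at h1
    exact Finset.disjoint_left.1 hAB ha
      ((eval_rootPoly_eq_zero_iff B a).1 (eq_zero_of_pow_eq_zero h1))
  let T : Finset (P1 k) := insert (infinitePoint k) ((rootPoly A * g).roots.toFinset.image affinePoint)
  have hT : {z : P1 k | rootForm B z.rep ^ β / rootForm A z.rep ^ α = e} ⊆ T := by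
    intro z hz
    rcases eq_affinePoint_or_eq_infinitePoint z with ⟨a, rfl⟩ | rfl
    · refine Finset.mem_coe.2 (Finset.mem_insert_of_mem (Finset.mem_image_of_mem _ ?_))
      rw [Multiset.mem_toFinset, Polynomial.mem_roots (mul_ne_zero (rootPoly_monic A).ne_zero hg),
        Polynomial.IsRoot.def, Polynomial.eval_mul, mul_eq_zero]
      obtain ⟨s, hs, hrep⟩ := exists_rep_affinePoint a
      by_cases ha : (rootPoly A).eval a = 0
      · exact .inl ha
      · right
        have hsa : (affinePoint a).rep 0 ≠ 0 := by simpa [hrep] using hs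
        have hq : (affinePoint a).rep 1 / (affinePoint a).rep 0 = a := by
          simp [hrep, mul_div_cancel_left₀ a hs]
        rw [Set.mem_ofPred_eq, rootForm_eq_eval _ hsa, rootForm_eq_eval _ hsa, hq, mul_pow, mul_pow,
          ← pow_mul, ← pow_mul, hcard, mul_div_mul_left _ _ (pow_ne_zero _ hsa),
          div_eq_iff (pow_ne_zero _ ha)] at hz
        simp [g, hz]
    · exact Finset.mem_coe.2 (Finset.mem_insert_self _ _)
  refine ⟨T.finite_toSet.subset hT, (Set.ncard_le_ncard hT T.finite_toSet).trans ?_⟩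
  rw [Set.ncard_coe_finset]
  refine (Finset.card_insert_le _ _).trans ?_
  rw [add_comm]
  refine Nat.add_le_add_left (Finset.card_image_le.trans ?_) 1
  refine (Multiset.toFinset_card_le _).trans ((Polynomial.card_roots' _).trans ?_)
  refine Polynomial.natDegree_mul_le.trans ?_
  rw [natDegree_rootPoly]
  refine Nat.add_le_add_left ((Polynomial.natDegree_sub_le _ _).trans (max_le ?_ ?_)) _
  · refine Polynomial.natDegree_pow_le.trans ?_
    rw [natDegree_rootPoly, hcard, mul_comm]
  · refine (Polynomial.natDegree_C_mul_le _ _).trans (Polynomial.natDegree_pow_le.trans ?_)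
    rw [natDegree_rootPoly, mul_comm]

/-- A correspondence with two disjoint regular pairs is finite. -/
theorem isFiniteCorrespondence_of_isRegularPair [IsAlgClosed k] {A A' : Fin 2 → Finset k}
    (hirr : Irreducible p) (hp : ∀ l, 0 < p.degreeOf l) (hA : IsRegularPair p A)
    (hA' : IsRegularPair p A') (hne : (A 0).Nonempty) (hne' : (A' 0).Nonempty)
    (hdisj : ∀ i, Disjoint (A i) (A' i)) : IsFiniteCorrespondence p := by
  have : Infinite k := IsAlgClosed.instInfinite
  obtain ⟨c, hc, hdvd⟩ := exists_dvd_separated hirr hp hA hA'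
  have hα : (A' 0).card * p.degreeOf 1 ≠ 0 := (Nat.mul_pos hne'.card_pos (hp 1)).ne'
  have hβ : (A 0).card * p.degreeOf 1 ≠ 0 := (Nat.mul_pos hne.card_pos (hp 1)).ne'
  have h0 : (A 0).card * ((A' 0).card * p.degreeOf 1) =
      (A' 0).card * ((A 0).card * p.degreeOf 1) := by ring
  have h1 : (A 1).card * ((A' 0).card * p.degreeOf 1) =
      (A' 1).card * ((A 0).card * p.degreeOf 1) := by
    rw [card_mul_degreeOf_eq hA hp, card_mul_degreeOf_eq hA' hp]; ring
  set α := (A' 0).card * p.degreeOf 1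
  set β := (A 0).card * p.degreeOf 1
  -- By `h0` numerator and denominator have equal degree, so the quotient does not depend on the
  -- representative.
  let F : P1 k → k := fun z => rootForm (A' 0) z.rep ^ β / rootForm (A 0) z.rep ^ α
  have hF : ∀ z w, (z, w) ∈ curve p →
      F z = c * (rootForm (A' 1) w.rep ^ β / rootForm (A 1) w.rep ^ α) := by
    intro z w hzw
    have hrel := rootForm_relation h0 h1 hdvd (v := z.rep) (w := w.rep) hzw
    -- Poles on the two sides correspond, since numerator and denominator have no common zero; there
    -- both sides take the default value 0.
    by_cases hz : rootForm (A 0) z.rep = 0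
    · rw [hz, zero_pow hα, zero_mul, mul_zero, mul_eq_zero] at hrel
      have hw := hrel.resolve_right
        (pow_ne_zero _ (rootForm_ne_zero_of_disjoint (hdisj 0) z hz))
      simp only [F]
      rw [hw, hz, zero_pow hα, div_zero, div_zero, mul_zero]
    · by_cases hw : rootForm (A 1) w.rep = 0
      · rw [hw, zero_pow hα, zero_mul] at hrel
        exact absurd hrel.symm (mul_ne_zero hc (mul_ne_zero (pow_ne_zero _ hz)
          (pow_ne_zero _ (rootForm_ne_zero_of_disjoint (hdisj 1) w hw))))
      · simp only [F]
        rw [← mul_div_assoc, div_eq_div_iff (pow_ne_zero _ hz) (pow_ne_zero _ hw)]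
        linear_combination hrel
  refine ⟨1 + ((A 0).card + (A 0).card * α), by omega, ?_⟩
  refine iter_eq_iter_succ (roundTrip_refl (hp 1)) F ?_ _
    fun e => fibre_rootForm_quotient hα h0 hne (hdisj 0) e
  rintro z z' ⟨w, hzw, hzw'⟩
  rw [hF z w hzw, hF z' w hzw']

end ProjectiveLine

/-! ### Finite orbits, exceptional values and the final count. -/

section Orbits

variable {k : Type*} [Field k] {p : MvPolynomial (Fin 2) k}

/-- The two coordinates of a point of the curve. -/
def coordinate (i : Fin 2) (z : curve p) : P1 k := if i = 0 then z.1.1 else z.1.2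

lemma mem_of_coordinate_eq {O : Set (curve p)} (hO : O ∈ (orbitSetoid p).classes) {x y : curve p}
    (hx : x ∈ O) {i : Fin 2} (h : coordinate i x = coordinate i y) : y ∈ O := by
  obtain ⟨z, rfl⟩ := hO
  have hyx : orbitSetoid p y x := by
    refine Relation.EqvGen.rel _ _ ?_
    rcases (by omega : i = 0 ∨ i = 1) with rfl | rfl
    · exact .inl (by simpa [coordinate] using h.symm)
    · exact .inr (by simpa [coordinate] using h.symm)
  exact (orbitSetoid p).trans hyx hx

lemma eq_of_mem_of_coordinate_eq {O O' : Set (curve p)} (hO : O ∈ (orbitSetoid p).classes)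
    (hO' : O' ∈ (orbitSetoid p).classes) {x y : curve p} (hx : x ∈ O) (hy : y ∈ O') {i : Fin 2}
    (h : coordinate i x = coordinate i y) : O = O' :=
  Setoid.eq_of_mem_classes hO (mem_of_coordinate_eq hO hx h) hO' hy

lemma exists_coordinate_eq_affinePoint {i j : Fin 2} (hij : i ≠ j) {a b : k}
    (h : (slice i a p).eval b = 0) :
    ∃ y : curve p, coordinate i y = affinePoint a ∧ coordinate j y = affinePoint b := by
  rcases (by omega : i = 0 ∧ j = 1 ∨ i = 1 ∧ j = 0) with ⟨rfl, rfl⟩ | ⟨rfl, rfl⟩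
  · refine ⟨⟨(affinePoint a, affinePoint b), (affinePoint_mem_curve_iff a b).2 ?_⟩, rfl, rfl⟩
    rw [← slice_eval hij a ![a, b] rfl]; exact h
  · refine ⟨⟨(affinePoint b, affinePoint a), (affinePoint_mem_curve_iff b a).2 ?_⟩, rfl, rfl⟩
    rw [← slice_eval hij a ![b, a] rfl]; exact h

lemma exists_coordinate_eq_infinitePoint {i j : Fin 2} (hij : i ≠ j) {a : k}
    (h : (slice i a p).coeff (p.degreeOf j) = 0) :
    ∃ y : curve p, coordinate i y = affinePoint a ∧ coordinate j y = infinitePoint k := by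
  rcases (by omega : i = 0 ∧ j = 1 ∨ i = 1 ∧ j = 0) with ⟨rfl, rfl⟩ | ⟨rfl, rfl⟩
  · refine ⟨⟨(affinePoint a, infinitePoint k), (mem_curve_mk p _ _ _ _).2 ?_⟩, rfl, rfl⟩
    rw [biEval_infinite_right, h]
  · refine ⟨⟨(infinitePoint k, affinePoint a), (mem_curve_mk p _ _ _ _).2 ?_⟩, rfl, rfl⟩
    rw [biEval_infinite_left, h]

variable (p) in
open scoped Classical in
/-- The values of the coordinate `i` that are infinite or zeros of the ramification polynomial. -/
def exceptionalValues (i : Fin 2) : Finset (P1 k) :=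
  insert (infinitePoint k) ((ramificationPoly i p).roots.toFinset.image affinePoint)

lemma card_exceptionalValues_le {i j : Fin 2} (hij : i ≠ j) :
    (exceptionalValues p i).card ≤ 2 * p.degreeOf j * p.degreeOf i + 1 := by
  classical
  refine (Finset.card_insert_le _ _).trans (Nat.add_le_add_right ?_ 1)
  refine Finset.card_image_le.trans ((Multiset.toFinset_card_le _).trans ?_)
  exact (Polynomial.card_roots' _).trans (natDegree_ramificationPoly_le hij p)

/-- The affine values of the two coordinates on a finite orbit without exceptional values form a
regular pair. -/
lemma exists_isRegularPair [IsAlgClosed k] [CharZero k] (hirr : Irreducible p)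
    (hp : ∀ l, 0 < p.degreeOf l) {O : Set (curve p)} (hO : O ∈ finiteOrbits p)
    (hgood : ∀ x ∈ O, ∀ i, coordinate i x ∉ exceptionalValues p i) :
    ∃ A : Fin 2 → Finset k, IsRegularPair p A ∧
      (∀ i a, a ∈ A i ↔ ∃ x ∈ O, coordinate i x = affinePoint a) ∧ (A 0).Nonempty := by
  classical
  obtain ⟨hclass, hfin⟩ := hO
  have hfin' : ∀ i : Fin 2, (affinePoint ⁻¹' (coordinate i '' O) : Set k).Finite := fun i =>
    (hfin.image _).preimage affinePoint_injective.injOn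
  have hinf : ∀ x ∈ O, ∀ i, coordinate i x ≠ infinitePoint k := fun x hx i h =>
    hgood x hx i (h ▸ Finset.mem_insert_self _ _)
  have hmem : ∀ i a, a ∈ (hfin' i).toFinset ↔ ∃ x ∈ O, coordinate i x = affinePoint a := by
    simp
  refine ⟨fun i => (hfin' i).toFinset, ?_, hmem, ?_⟩
  · intro i j hij a ha
    obtain ⟨x, hx, hxa⟩ := (hmem i a).1 ha
    -- A drop of degree would put a point with infinite coordinate `j` into the orbit.
    have hdeg : (slice i a p).natDegree = p.degreeOf j := by
      refine le_antisymm (natDegree_slice_le hij a p) (Polynomial.le_natDegree_of_ne_zero ?_)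
      intro h
      obtain ⟨y, hya, hy⟩ := exists_coordinate_eq_infinitePoint hij h
      exact hinf y (mem_of_coordinate_eq hclass hx (hxa.trans hya.symm)) j hy
    refine ⟨hdeg, ?_⟩
    have hne : slice i a p ≠ 0 := by
      intro h0
      rw [h0, Polynomial.natDegree_zero] at hdeg
      exact (hp j).ne hdeg
    have hram : (ramificationPoly i p).eval a ≠ 0 := by
      intro h
      refine hgood x hx i (hxa ▸ Finset.mem_insert_of_mem (Finset.mem_image_of_mem _ ?_))
      rw [Multiset.mem_toFinset, Polynomial.mem_roots (ramificationPoly_ne_zero hij hirr (hp j))]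
      exact h
    have hnodup := Polynomial.nodup_roots (separable_slice_of_eval_ne_zero hij (hp j) hram)
    have hsub : (slice i a p).roots.toFinset ⊆ (hfin' j).toFinset := by
      intro b hb
      rw [Multiset.mem_toFinset, Polynomial.mem_roots hne] at hb
      obtain ⟨y, hya, hyb⟩ := exists_coordinate_eq_affinePoint hij hb
      exact (hmem j b).2 ⟨y, mem_of_coordinate_eq hclass hx (hxa.trans hya.symm), hyb⟩
    rw [(IsAlgClosed.splits (slice i a p)).eq_prod_roots,
      (Polynomial.isUnit_C.2 (Polynomial.leadingCoeff_ne_zero.2 hne).isUnit).mul_left_dvd]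
    have hroots : ((slice i a p).roots.map fun b => Polynomial.X - Polynomial.C b).prod =
        ∏ b ∈ (slice i a p).roots.toFinset, (Polynomial.X - Polynomial.C b) := by
      rw [Finset.prod, Multiset.toFinset_val, hnodup.dedup]
    rw [hroots]
    exact Finset.prod_dvd_prod_of_subset _ _ _ hsub
  · obtain ⟨x, hx⟩ := Setoid.nonempty_of_mem_partition ((orbitSetoid p).isPartition_classes) hclass
    rcases eq_affinePoint_or_eq_infinitePoint (coordinate 0 x) with ⟨a, ha⟩ | h
    · exact ⟨a, (hmem 0 a).2 ⟨x, hx, ha⟩⟩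
    · exact absurd h (hinf x hx 0)

/-- Different orbits share no coordinate value, so their regular pairs would be disjoint and would
make the correspondence finite. -/
lemma finiteOrbits_eq_of_disjoint_exceptionalValues [IsAlgClosed k] [CharZero k]
    (hirr : Irreducible p) (hp : ∀ l, 0 < p.degreeOf l) (hinf : ¬ IsFiniteCorrespondence p)
    {O O' : Set (curve p)} (hO : O ∈ finiteOrbits p) (hO' : O' ∈ finiteOrbits p)
    (hgood : ∀ x ∈ O, ∀ i, coordinate i x ∉ exceptionalValues p i)
    (hgood' : ∀ x ∈ O', ∀ i, coordinate i x ∉ exceptionalValues p i) : O = O' := by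
  by_contra hne
  obtain ⟨A, hA, hmem, hn⟩ := exists_isRegularPair hirr hp hO hgood
  obtain ⟨A', hA', hmem', hn'⟩ := exists_isRegularPair hirr hp hO' hgood'
  refine hinf (isFiniteCorrespondence_of_isRegularPair hirr hp hA hA' hn hn' fun i => ?_)
  rw [Finset.disjoint_left]
  intro a ha ha'
  obtain ⟨x, hx, hxa⟩ := (hmem i a).1 ha
  obtain ⟨y, hy, hya⟩ := (hmem' i a).1 ha'
  exact hne (eq_of_mem_of_coordinate_eq hO.1 hO'.1 hx hy (hxa.trans hya.symm))

/-- An infinite correspondence has at most one finite orbit without exceptional values, and every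
other finite orbit is determined by an exceptional value of one of the coordinates. -/
theorem finiteOrbits_finite_and_ncard_le [IsAlgClosed k] [CharZero k]
    (hirr : Irreducible p) (hp : ∀ l, 0 < p.degreeOf l) (hinf : ¬ IsFiniteCorrespondence p) :
    (finiteOrbits p).Finite ∧
      (finiteOrbits p).ncard ≤ 2 * (2 * p.degreeOf 0 * p.degreeOf 1 + 1) + 1 := by
  classical
  let G : Set (Set (curve p)) :=
    {O ∈ finiteOrbits p | ∀ x ∈ O, ∀ i, coordinate i x ∉ exceptionalValues p i}
  let E : Set (Set (curve p)) :=
    {O ∈ finiteOrbits p | ∃ x ∈ O, ∃ i, coordinate i x ∈ exceptionalValues p i}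
  have hunion : finiteOrbits p = E ∪ G := by
    ext O
    constructor
    · intro hO
      by_cases h : ∃ x ∈ O, ∃ i, coordinate i x ∈ exceptionalValues p i
      · exact .inl ⟨hO, h⟩
      · push Not at h
        exact .inr ⟨hO, h⟩
    · rintro (h | h)
      exacts [h.1, h.1]
  have hG : G.Subsingleton := fun O hO O' hO' =>
    finiteOrbits_eq_of_disjoint_exceptionalValues hirr hp hinf hO.1 hO'.1 hO.2 hO'.2
  -- The index records which coordinate takes the exceptional value; with it, the value determines
  -- the orbit.
  let T : Finset (Σ _ : Fin 2, P1 k) := Finset.univ.sigma fun i => exceptionalValues p i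
  have hex : ∀ O : E, ∃ t : Σ _ : Fin 2, P1 k, t ∈ T ∧ ∃ x ∈ O.1, coordinate t.1 x = t.2 := by
    rintro ⟨O, -, x, hx, i, hi⟩
    exact ⟨⟨i, coordinate i x⟩, by simpa [T] using hi, x, hx, rfl⟩
  choose f hfT hf using hex
  have hinj : Function.Injective f := by
    intro O O' h
    obtain ⟨x, hx, hxO⟩ := hf O
    obtain ⟨y, hy, hyO⟩ := hf O'
    rw [← h] at hyO
    exact Subtype.ext (eq_of_mem_of_coordinate_eq O.2.1.1 O'.2.1.1 hx hy (hxO.trans hyO.symm))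
  let f' : E → T := fun O => ⟨f O, hfT O⟩
  have hinj' : Function.Injective f' := fun O O' h => hinj (congrArg Subtype.val h)
  have hEfin : E.Finite := Set.finite_coe_iff.1 (Finite.of_injective f' hinj')
  have hEcard : E.ncard ≤ T.card := by
    have := Nat.card_le_card_of_injective f' hinj'
    simpa using this
  have hT : T.card ≤ 2 * (2 * p.degreeOf 0 * p.degreeOf 1 + 1) := by
    have h0 := card_exceptionalValues_le (p := p) (i := 0) (j := 1) (by decide)
    have h1 := card_exceptionalValues_le (p := p) (i := 1) (j := 0) (by decide)
    rw [Finset.card_sigma, Fin.sum_univ_two]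
    rw [mul_right_comm] at h0
    omega
  rw [hunion]
  refine ⟨hEfin.union hG.finite, (Set.ncard_union_le _ _).trans ?_⟩
  exact Nat.add_le_add (hEcard.trans hT) ((Set.ncard_le_one hG.finite).2 hG)

end Orbits

end PlaneCorrespondence

end

theorem theorem3p2 :
    ∃ B : ℕ → ℕ,
      ∀ (k : Type*) [Field k] [IsAlgClosed k] [CharZero k] (p : MvPolynomial (Fin 2) k),
        Irreducible p →
        p ∉ MvPolynomial.supported k ({0} : Set (Fin 2)) →
        p ∉ MvPolynomial.supported k ({1} : Set (Fin 2)) →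
        PlaneCorrespondence.IsNormalCurve p →
        ¬ PlaneCorrespondence.IsFiniteCorrespondence p →
        (PlaneCorrespondence.finiteOrbits p).Finite ∧
          (PlaneCorrespondence.finiteOrbits p).ncard ≤ B p.totalDegree := by
  -- Per coordinate, at most 2d² ramification values and infinity; the last 1 is the possible
  -- unexceptional orbit.
  refine ⟨fun d => 2 * (2 * d * d + 1) + 1, fun k _ _ _ p hirr h0 h1 _ hinf => ?_⟩
  have hp : ∀ l, 0 < p.degreeOf l := Fin.forall_fin_two.2
    ⟨PlaneCorrespondence.degreeOf_pos_of_notMem_supported (by decide) h1,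
      PlaneCorrespondence.degreeOf_pos_of_notMem_supported (by decide) h0⟩
  obtain ⟨hfin, hcard⟩ := PlaneCorrespondence.finiteOrbits_finite_and_ncard_le hirr hp hinf
  refine ⟨hfin, hcard.trans ?_⟩
  have e0 := MvPolynomial.degreeOf_le_totalDegree p 0
  have e1 := MvPolynomial.degreeOf_le_totalDegree p 1
  exact Nat.add_le_add_right (Nat.mul_le_mul_left 2 (Nat.add_le_add_right
    (Nat.mul_le_mul (Nat.mul_le_mul_left 2 e0) e1) 1)) 1
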